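/- Let $\omega>0$, $\kappa>0$ and $\gamma\ge 0$ be constants. For $\mathbf r=(r_x,r_y,r_z)\in\mathbb R^3$ put \[ f_0(\mathbf r)=\begin{pmatrix}-r_y\\ r_x\\ 0\end{pmatrix}-\frac{\gamma}{\omega}\begin{pmatrix}\tfrac12 r_x\\ \tfrac12 r_y\\ r_z\end{pmatrix}+\frac{\gamma}{\omega}\begin{pmatrix}0\\0\\1\end{pmatrix},\qquad f_1(\mathbf r)=\begin{pmatrix}0\\-r_z\\ r_y\end{pmatrix},\qquad f_2(\mathbf r)=-\begin{pmatrix}\tfrac12 r_x\\ \tfrac12 r_y\\ r_z\end{pmatrix}, \] and consider the control system for the Bloch vector of a qubit \[ \dot{\mathbf r}=\omega f_0(\mathbf r)+2\kappa f_1(\mathbf r)\,u+\gamma f_2(\mathbf r)\,n , \] where $u$ is the coherent control and $n\ge 0$ is the incoherent control. For $\mathbf r^0\in\mathbb R^3$ let $B_+(\mathbf r^0)$ be the set of all $\mathbf r^1\in\mathbb R^3$ for which there are $T\ge 0$, controls $u,n\in L^1([0,T];\mathbb R)$ with $n\ge 0$, and an absolutely continuous $\mathbf r:[0,T]\to\mathbb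 R^3$ that satisfies the system almost everywhere, with $\mathbf r(0)=\mathbf r^0$ and $\mathbf r(T)=\mathbf r^1$. Let $C_+(\mathbf r^0)$ be the set defined in the same way but with $n\equiv 0$. Then for every $\mathbf r^0\in\mathbb R^3$ (in particular, for every $\mathbf r^0$ in the Bloch ball $|\mathbf r^0|\le 1$) \[ \operatorname{cl} C_+(\mathbf r^0)=\operatorname{cl} B_+(\mathbf r^0); \] that is, the sets of points asymptotically reachable from $\mathbf r^0$ with and without incoherent control coincide. -/

import Mathlib

open MeasureTheory

namespace BlochControl

noncomputable section

/-- Bloch vectors `r = (r_x, r_y, r_z)`, with coordinates indexed by `0, 1, 2`. -/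
abbrev BlochVec : Type := EuclideanSpace ℝ (Fin 3)

/-- The drift field `f₀` (free precession about the third axis plus decoherence). -/
def f₀ (ω γ : ℝ) (r : BlochVec) : BlochVec :=
  !₂[-(r 1), r 0, 0] - (γ / ω) • !₂[1 / 2 * r 0, 1 / 2 * r 1, r 2] + (γ / ω) • !₂[0, 0, 1]

/-- The field `f₁` multiplying the coherent control (rotation about the first axis). -/
def f₁ (r : BlochVec) : BlochVec :=
  !₂[0, -(r 2), r 1]

/-- The field `f₂` multiplying the incoherent control. -/
def f₂ (r : BlochVec) : BlochVec :=
  -!₂[1 / 2 * r 0, 1 / 2 * r 1, r 2]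

/-- The right-hand side `ω f₀(r) + 2 κ f₁(r) u + γ f₂(r) n` of the control system. -/
def velocity (ω κ γ : ℝ) (r : BlochVec) (u n : ℝ) : BlochVec :=
  ω • f₀ ω γ r + (2 * κ * u) • f₁ r + (γ * n) • f₂ r

/-- `r` is an (absolutely continuous, Carathéodory) solution of the control system on `[0, T]`
with controls `u`, `n` and initial value `r⁰`. For controls in `L¹(0, T)` the integrand is
integrable, and the integral equation says exactly that `r` is absolutely continuous,
starts at `r⁰` and satisfies the differential equation almost everywhere. -/
def IsTrajectory (ω κ γ T : ℝ) (u n : ℝ → ℝ) (r₀ : BlochVec) (r : ℝ → BlochVec) : Prop :=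
  ContinuousOn r (Set.Icc 0 T) ∧
    ∀ t ∈ Set.Icc 0 T, r t = r₀ + ∫ s in (0 : ℝ)..t, velocity ω κ γ (r s) (u s) (n s)

/-- `B₊(r⁰)`: the points reachable from `r⁰` in some time `T ≥ 0` with a coherent control
`u ∈ L¹(0, T)` and an incoherent control `n ∈ L¹(0, T)`, `n ≥ 0`. -/
def reachableBoth (ω κ γ : ℝ) (r₀ : BlochVec) : Set BlochVec :=
  {r₁ | ∃ (T : ℝ) (u n : ℝ → ℝ) (r : ℝ → BlochVec), 0 ≤ T ∧
    IntegrableOn u (Set.Icc 0 T) volume ∧ IntegrableOn n (Set.Icc 0 T) volume ∧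
    (∀ t ∈ Set.Icc 0 T, 0 ≤ n t) ∧
    IsTrajectory ω κ γ T u n r₀ r ∧ r T = r₁}

/-- `C₊(r⁰)`: the points reachable from `r⁰` in some time `T ≥ 0` with a coherent control
`u ∈ L¹(0, T)` only, that is with `n ≡ 0`. -/
def reachableCoherent (ω κ γ : ℝ) (r₀ : BlochVec) : Set BlochVec :=
  {r₁ | ∃ (T : ℝ) (u : ℝ → ℝ) (r : ℝ → BlochVec), 0 ≤ T ∧
    IntegrableOn u (Set.Icc 0 T) volume ∧
    IsTrajectory ω κ γ T u (fun _ => 0) r₀ r ∧ r T = r₁}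

end

end BlochControl

/-! Let `S` be the closure of the coherently reachable set. In homogeneous coordinates the drift is
linear, and `S` is invariant under its flow, also with constant coherent control. Strong short
pulses in the limit give the rotations about the first axis (`mapsTo_exp_rot`). Conjugating the
drift by the rotation through π reverses precession and the inhomogeneous term but keeps the decay,
so drift plus conjugated drift is a multiple of `f₂`. Hence every admissible velocity, with `n ≥ 0`,
is tangent to `S` (`exists_tangent_curve`). Each velocity field is dissipative, so the squared
distance from a trajectory to `S` cannot grow (`mem_of_dissipative_of_tangent`). No approximation of
the controls is needed. -/

namespace BlochControl

/-! ### Viability of closed sets under dissipative fields -/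

/-- A function whose increments are dominated by those of an absolutely continuous function is
absolutely continuous. -/
theorem absolutelyContinuousOnInterval_of_dist_le {X Y : Type*} [PseudoMetricSpace X]
    [PseudoMetricSpace Y] {φ : ℝ → X} {G : ℝ → Y} {a b : ℝ}
    (hG : AbsolutelyContinuousOnInterval G a b)
    (h : ∀ s ∈ Set.uIcc a b, ∀ t ∈ Set.uIcc a b, dist (φ s) (φ t) ≤ dist (G s) (G t)) :
    AbsolutelyContinuousOnInterval φ a b := by
  rw [absolutelyContinuousOnInterval_iff] at hG ⊢
  intro ε hε
  obtain ⟨δ, hδ, H⟩ := hG ε hε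
  refine ⟨δ, hδ, fun I hI hlt => lt_of_le_of_lt (Finset.sum_le_sum fun i hi => ?_) (H I hI hlt)⟩
  have := hI.1 i hi
  exact h _ this.1 _ this.2

/-- An absolutely continuous function with nonpositive derivative almost everywhere does not
increase. -/
theorem le_of_ae_hasDerivAt_nonpos {φ : ℝ → ℝ} {a b : ℝ} (hab : a ≤ b)
    (hφ : AbsolutelyContinuousOnInterval φ a b)
    (hd : ∀ᵐ t, t ∈ Set.Ioo a b → ∀ d, HasDerivAt φ d t → d ≤ 0) : φ b ≤ φ a := by
  have hint := hφ.integral_deriv_eq_sub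
  have hnonneg : 0 ≤ ∫ t in a..b, -deriv φ t := by
    refine intervalIntegral.integral_nonneg_of_ae_restrict hab ?_
    have hIoo : ∀ᵐ t ∂(volume.restrict (Set.Icc a b)), t ∈ Set.Ioo a b := by
      rw [← restrict_Ioo_eq_restrict_Icc]
      exact ae_restrict_mem measurableSet_Ioo
    filter_upwards [hIoo, ae_restrict_of_ae hd, ae_restrict_of_ae hφ.ae_differentiableAt]
      with t ht h1 h2
    have hdiff := h2 (by rw [Set.uIcc_of_le hab]; exact Set.Ioo_subset_Icc_self ht)
    have := h1 ht _ hdiff.hasDerivAt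
    simpa using this
  rw [intervalIntegral.integral_neg, hint] at hnonneg
  linarith

/-- The derivative at the left end of a half-line on which a function stays above its initial
value is nonnegative. -/
theorem derivative_nonneg_of_forall_ge {ψ : ℝ → ℝ} {d : ℝ} (hψ : HasDerivAt ψ d 0)
    (h : ∀ s, 0 ≤ s → ψ 0 ≤ ψ s) : 0 ≤ d := by
  have hs := (hasDerivAt_iff_tendsto_slope_left_right.mp hψ).2
  refine ge_of_tendsto hs ?_
  filter_upwards [self_mem_nhdsWithin] with s hs
  have hs' : (0 : ℝ) < s := hs
  rw [slope_def_field]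
  exact div_nonneg (sub_nonneg.2 (h s hs'.le)) (by linarith)

/-- Viability of a closed set along Carathéodory trajectories of a dissipative field, if the
field is tangent to the set. -/
theorem mem_of_dissipative_of_tangent {E : Type*} [NormedAddCommGroup E] [InnerProductSpace ℝ E]
    [ProperSpace E] [CompleteSpace E] {S : Set E} (hS : IsClosed S) {T : ℝ} (hT : 0 ≤ T)
    {f : ℝ → E → E} {r : ℝ → E} {r₀ : E} (hr₀ : r₀ ∈ S)
    (hint : IntervalIntegrable (fun s => f s (r s)) volume 0 T)
    (hr : ∀ t ∈ Set.Icc 0 T, r t = r₀ + ∫ s in (0 : ℝ)..t, f s (r s))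
    (hdiss : ∀ t ∈ Set.Icc 0 T, ∀ x y, inner ℝ (x - y) (f t x - f t y) ≤ 0)
    (htan : ∀ t ∈ Set.Icc 0 T, ∀ y ∈ S, ∃ c : ℝ → E, c 0 = y ∧ HasDerivAt c (f t y) 0 ∧
      ∀ h, 0 ≤ h → c h ∈ S) : r T ∈ S := by
  have hne : S.Nonempty := ⟨r₀, hr₀⟩
  have hIcc : Set.uIcc 0 T = Set.Icc 0 T := Set.uIcc_of_le hT
  have hsub : ∀ s ∈ Set.Icc 0 T, IntervalIntegrable (fun s => f s (r s)) volume 0 s := by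
    intro s hs
    refine hint.mono_set ?_
    rw [hIcc, Set.uIcc_of_le hs.1]
    exact Set.Icc_subset_Icc_right hs.2
  set φ : ℝ → ℝ := fun t => Metric.infDist (r t) S with hφdef
  have hφ : AbsolutelyContinuousOnInterval φ 0 T := by
    refine absolutelyContinuousOnInterval_of_dist_le
      (hint.norm.absolutelyContinuousOnInterval_intervalIntegral (c := 0) (by simp)) ?_
    rw [hIcc]
    intro s hs t ht
    have h1 : dist (φ s) (φ t) ≤ dist (r s) (r t) := by
      simpa using (Metric.lipschitz_infDist_pt S).dist_le_mul (r s) (r t)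
    refine h1.trans ?_
    rw [hr s hs, hr t ht, dist_add_left, dist_eq_norm, dist_eq_norm,
      intervalIntegral.integral_interval_sub_left (hsub s hs) (hsub t ht),
      intervalIntegral.integral_interval_sub_left (hsub s hs).norm (hsub t ht).norm]
    exact intervalIntegral.norm_integral_le_abs_integral_norm
  -- The square is used because `‖·‖ ^ 2` is differentiable everywhere and its derivative is the
  -- inner product in `hdiss`.
  have hle : (φ * φ) T ≤ (φ * φ) 0 := by
    refine le_of_ae_hasDerivAt_nonpos hT (hφ.mul hφ) ?_
    filter_upwards [hint.ae_hasDerivAt_integral] with t hderiv ht d hd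
    have htI := Set.Ioo_subset_Icc_self ht
    have hrt : HasDerivAt r (f t (r t)) t := by
      have h1 := (hderiv (by rwa [hIcc]) 0 (by simp)).const_add r₀
      refine h1.congr_of_eventuallyEq ?_
      filter_upwards [Ioo_mem_nhds ht.1 ht.2] with s hs using hr s (Set.Ioo_subset_Icc_self hs)
    obtain ⟨y, hyS, hy⟩ := hS.exists_infDist_eq_dist hne (r t)
    obtain ⟨c, hc0, hc, hcS⟩ := htan t htI y hyS
    have hrt' : HasDerivAt (fun h => r (t + h)) (f t (r t)) 0 :=
      HasDerivAt.comp_const_add t 0 (by simpa using hrt)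
    have hd' : HasDerivAt (fun h => (φ * φ) (t + h)) d 0 :=
      HasDerivAt.comp_const_add t 0 (by simpa using hd)
    -- With `y` a nearest point of `S`, `‖r (t + s) - c s‖ ^ 2 - φ (t + s) ^ 2` is nonnegative for
    -- `s ≥ 0` and vanishes at `s = 0`, so `d` is at most `2⟪r t - y, f t (r t) - f t y⟫`.
    have hψ := (hrt'.sub hc).norm_sq.sub hd'
    have h0 := derivative_nonneg_of_forall_ge hψ (fun s hs => by
      have h1 : φ (t + s) ≤ ‖r (t + s) - c s‖ := by
        rw [← dist_eq_norm]
        exact Metric.infDist_le_dist_of_mem (hcS s hs)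
      have h2 : 0 ≤ φ (t + s) := Metric.infDist_nonneg
      have h3 : φ t = ‖r t - y‖ := by rw [← dist_eq_norm]; exact hy
      simp only [Pi.sub_apply, Pi.mul_apply, add_zero, hc0, h3]
      nlinarith)
    have h4 := hdiss t htI (r t) y
    simp only [Pi.sub_apply, add_zero, hc0] at h0
    linarith
  have h00 : φ 0 = 0 := by
    have : r 0 = r₀ := by simpa using hr 0 ⟨le_rfl, hT⟩
    simp [φ, this, Metric.infDist_zero_of_mem hr₀]
  have hT0 : φ T = 0 := by
    simp only [Pi.mul_apply, h00, mul_zero] at hle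
    exact mul_self_eq_zero.1 (le_antisymm hle (mul_self_nonneg _))
  exact (hS.mem_iff_infDist_zero hne).2 hT0

noncomputable section

/-! ### Homogeneous coordinates and the velocity field -/

/-- The drift, made linear on homogeneous coordinates; it agrees with `ω f₀` where the last
coordinate is `1`. -/
def driftOp (ω γ : ℝ) : (Fin 4 → ℝ) →L[ℝ] (Fin 4 → ℝ) :=
  LinearMap.toContinuousLinearMap (Matrix.toLin'
    !![-(γ / 2), -ω, 0, 0; ω, -(γ / 2), 0, 0; 0, 0, -γ, γ; 0, 0, 0, 0])

/-- The rotation generator `f₁` in homogeneous coordinates. -/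
def rotOp : (Fin 4 → ℝ) →L[ℝ] (Fin 4 → ℝ) :=
  LinearMap.toContinuousLinearMap (Matrix.toLin'
    !![0, 0, 0, 0; 0, 0, -1, 0; 0, 1, 0, 0; 0, 0, 0, 0])

/-- The Bloch vector with given homogeneous coordinates. -/
def toBloch : (Fin 4 → ℝ) →L[ℝ] BlochVec :=
  LinearMap.toContinuousLinearMap
    { toFun := fun p => !₂[p 0, p 1, p 2]
      map_add' := fun p q => by ext i; fin_cases i <;> simp
      map_smul' := fun c p => by ext i; fin_cases i <;> simp }

/-- Homogeneous coordinates of a Bloch vector. -/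
def ofBloch (r : BlochVec) : Fin 4 → ℝ := ![r 0, r 1, r 2, 1]

theorem driftOp_apply (ω γ : ℝ) (p : Fin 4 → ℝ) :
    driftOp ω γ p = ![-(γ / 2) * p 0 - ω * p 1, ω * p 0 - γ / 2 * p 1, -γ * p 2 + γ * p 3, 0] := by
  ext i
  fin_cases i <;>
    simp [driftOp, Matrix.mulVec, dotProduct, Fin.sum_univ_succ, sub_eq_add_neg]

theorem rotOp_apply (p : Fin 4 → ℝ) : rotOp p = ![0, -(p 2), p 1, 0] := by
  ext i
  fin_cases i <;> simp [rotOp, Matrix.mulVec, dotProduct, Fin.sum_univ_succ]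

theorem toBloch_apply (p : Fin 4 → ℝ) : toBloch p = !₂[p 0, p 1, p 2] := rfl

theorem toBloch_ofBloch (r : BlochVec) : toBloch (ofBloch r) = r := by
  ext i
  fin_cases i <;> simp [toBloch_apply, ofBloch]

theorem ofBloch_toBloch {p : Fin 4 → ℝ} (hp : p 3 = 1) : ofBloch (toBloch p) = p := by
  ext i
  fin_cases i <;> simp [toBloch_apply, ofBloch, hp]

theorem continuous_ofBloch : Continuous ofBloch := by
  refine continuous_pi fun i => ?_
  fin_cases i <;> simp [ofBloch] <;> fun_prop

theorem velocity_eq {ω : ℝ} (hω : 0 < ω) (κ γ : ℝ) (r : BlochVec) (u n : ℝ) :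
    velocity ω κ γ r u n = !₂[-(ω * r 1) - γ * (1 + n) / 2 * r 0,
      ω * r 0 - γ * (1 + n) / 2 * r 1 - 2 * κ * u * r 2,
      -(γ * (1 + n) * r 2) + γ + 2 * κ * u * r 1] := by
  ext i
  fin_cases i <;> simp [velocity, f₀, f₁, f₂] <;> field_simp <;> ring

/-- Precession and coherent control are skew and the constant term cancels in the difference; only
the decay survives. -/
theorem inner_velocity_sub_nonpos {ω κ γ : ℝ} (hω : 0 < ω) (hγ : 0 ≤ γ) (u : ℝ) {n : ℝ}
    (hn : 0 ≤ n) (x y : BlochVec) :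
    inner ℝ (x - y) (velocity ω κ γ x u n - velocity ω κ γ y u n) ≤ 0 := by
  have h : inner ℝ (x - y) (velocity ω κ γ x u n - velocity ω κ γ y u n) =
      -(γ * (1 + n)) * (1 / 2 * (x 0 - y 0) ^ 2 + 1 / 2 * (x 1 - y 1) ^ 2 + (x 2 - y 2) ^ 2) := by
    rw [velocity_eq hω, velocity_eq hω]
    simp [PiLp.inner_apply, Fin.sum_univ_three]
    ring
  rw [h, neg_mul, neg_nonpos]
  positivity

theorem intervalIntegrable_velocity {ω : ℝ} (κ γ : ℝ) {a b : ℝ} (hab : a ≤ b)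
    {u n : ℝ → ℝ} (hu : IntegrableOn u (Set.Icc a b) volume)
    (hn : IntegrableOn n (Set.Icc a b) volume) {r : ℝ → BlochVec}
    (hr : ContinuousOn r (Set.Icc a b)) :
    IntervalIntegrable (fun s => velocity ω κ γ (r s) (u s) (n s)) volume a b := by
  have h₀ : Continuous (f₀ ω γ) := by unfold f₀; fun_prop
  have h₁ : Continuous f₁ := by unfold f₁; fun_prop
  have h₂ : Continuous f₂ := by unfold f₂; fun_prop
  rw [intervalIntegrable_iff_integrableOn_Icc_of_le hab]
  unfold velocity
  refine Integrable.add (Integrable.add ?_ ?_) ?_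
  · exact ((h₀.comp_continuousOn hr).const_smul ω).integrableOn_compact isCompact_Icc
  · exact IntegrableOn.smul_continuousOn (hu.const_mul (2 * κ)) (h₁.comp_continuousOn hr)
      isCompact_Icc
  · exact IntegrableOn.smul_continuousOn (hn.const_mul γ) (h₂.comp_continuousOn hr) isCompact_Icc

theorem self_mem_reachableCoherent (ω κ γ : ℝ) (r₀ : BlochVec) :
    r₀ ∈ reachableCoherent ω κ γ r₀ := by
  refine ⟨0, fun _ => 0, fun _ => r₀, le_rfl, by simp, ⟨continuousOn_const, ?_⟩, rfl⟩
  intro t ht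
  obtain rfl : t = 0 := le_antisymm ht.2 ht.1
  simp

/-! ### Concatenation and linear flows -/

/-- A coherently reachable point can be followed by a solution with constant control. -/
theorem mem_reachableCoherent_of_flow {ω κ γ : ℝ} {r₀ r₁ : BlochVec}
    (h : r₁ ∈ reachableCoherent ω κ γ r₀) (c : ℝ) {y : ℝ → BlochVec} (hy0 : y 0 = r₁)
    (hy : ∀ t, HasDerivAt y (velocity ω κ γ (y t) c 0) t) {τ : ℝ} (hτ : 0 ≤ τ) :
    y τ ∈ reachableCoherent ω κ γ r₀ := by
  obtain ⟨T, u, r, hT, hu, ⟨hrc, hr⟩, hrT⟩ := h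
  have hyc : Continuous y := continuous_iff_continuousAt.2 fun t => (hy t).continuousAt
  set u' : ℝ → ℝ := fun s => if s ≤ T then u s else c with hu'
  -- Clamping time with `min` and `max` glues the two arcs into one visibly continuous formula.
  set q : ℝ → BlochVec := fun t => r (min t T) + (y (max t T - T) - r₁) with hq
  have hql : ∀ t ≤ T, q t = r t := fun t ht => by simp [hq, ht, hy0]
  have hqr : ∀ t, T ≤ t → q t = y (t - T) := fun t ht => by simp [hq, ht, hrT]
  have hqc : ContinuousOn q (Set.Icc 0 (T + τ)) := by
    refine ContinuousOn.add (hrc.comp (by fun_prop) fun t ht => ⟨le_min ht.1 hT, min_le_right _ _⟩)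
      (Continuous.continuousOn (by fun_prop))
  have hu'i : IntegrableOn u' (Set.Icc 0 (T + τ)) volume := by
    rw [← Set.Icc_union_Ioc_eq_Icc hT (by linarith : T ≤ T + τ)]
    refine IntegrableOn.union ?_ ?_
    · exact hu.congr_fun (fun s hs => by simp [hu', hs.2]) measurableSet_Icc
    · refine (integrableOn_const (C := c) (by simp)).congr_fun (fun s hs => ?_) measurableSet_Ioc
      simp [hu', not_le.2 hs.1]
  refine ⟨T + τ, u', q, by linarith, hu'i, ⟨hqc, ?_⟩, by rw [hqr _ (by linarith)]; simp⟩
  have hleft : ∀ t ∈ Set.Icc 0 T, q t = r₀ + ∫ s in (0 : ℝ)..t, velocity ω κ γ (q s) (u' s) 0 := by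
    intro t ht
    rw [hql t ht.2, hr t ht]
    congr 1
    refine intervalIntegral.integral_congr fun s hs => ?_
    rw [Set.uIcc_of_le ht.1] at hs
    have hsT := hs.2.trans ht.2
    simp only [hql s hsT, hu', hsT, if_true]
  intro t ht
  rcases le_total t T with htT | htT
  · exact hleft t ⟨ht.1, htT⟩
  have hI := intervalIntegrable_velocity (ω := ω) κ γ (by linarith [ht.1] : (0 : ℝ) ≤ T + τ) hu'i
    (n := fun _ => 0) (by simp) hqc
  have hI1 : IntervalIntegrable (fun s => velocity ω κ γ (q s) (u' s) 0) volume 0 T :=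
    hI.mono_set (by
      rw [Set.uIcc_of_le hT, Set.uIcc_of_le (by linarith)]
      exact Set.Icc_subset_Icc_right (by linarith))
  have hI2 : IntervalIntegrable (fun s => velocity ω κ γ (q s) (u' s) 0) volume T t :=
    hI.mono_set (by
      rw [Set.uIcc_of_le htT, Set.uIcc_of_le (by linarith)]
      exact Set.Icc_subset_Icc hT ht.2)
  rw [← intervalIntegral.integral_add_adjacent_intervals hI1 hI2, ← add_assoc,
    ← hleft T ⟨hT, le_rfl⟩, hqr T le_rfl, hqr t htT, sub_self, hy0]
  have hd : ∀ s ∈ Set.uIcc T t,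
      HasDerivAt (fun s => y (s - T)) (velocity ω κ γ (y (s - T)) c 0) s :=
    fun s _ => HasDerivAt.comp_sub_const s T (hy (s - T))
  have hIy : IntervalIntegrable (fun s => velocity ω κ γ (y (s - T)) c 0) volume T t :=
    intervalIntegrable_velocity κ γ htT (u := fun _ => c) (n := fun _ => 0) (by simp) (by simp)
      (Continuous.continuousOn (by fun_prop))
  have hcongr : ∫ s in T..t, velocity ω κ γ (q s) (u' s) 0 =
      ∫ s in T..t, velocity ω κ γ (y (s - T)) c 0 := by
    -- The half-open interval matters: at `s = T` the control `u'` still equals `u T`, not `c`.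
    refine intervalIntegral.integral_congr_ae (Filter.Eventually.of_forall fun s hs => ?_)
    rw [Set.uIoc_of_le htT] at hs
    simp only [hqr s hs.1.le, hu', not_le.2 hs.1, if_false]
  rw [hcongr, intervalIntegral.integral_eq_sub_of_hasDerivAt hd hIy]
  simp [hy0]

theorem hasDerivAt_exp_smul_apply {F : Type*} [NormedAddCommGroup F] [NormedSpace ℝ F]
    [CompleteSpace F] (M : F →L[ℝ] F) (p : F) (t : ℝ) :
    HasDerivAt (fun s : ℝ => NormedSpace.exp (s • M) p) (M (NormedSpace.exp (t • M) p)) t := by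
  simpa using (hasDerivAt_exp_smul_const' (𝕂 := ℝ) M t).clm_apply (hasDerivAt_const t p)

/-- The last coordinate is preserved by the flow of an operator for which it has zero velocity. -/
theorem exp_apply_last (M : (Fin 4 → ℝ) →L[ℝ] (Fin 4 → ℝ)) (hM : ∀ p, M p 3 = 0)
    (p : Fin 4 → ℝ) : NormedSpace.exp M p 3 = p 3 := by
  have hd : ∀ t : ℝ, HasDerivAt (fun s : ℝ => NormedSpace.exp (s • M) p 3) 0 t := fun t => by
    simpa [hM] using hasDerivAt_pi.1 (hasDerivAt_exp_smul_apply M p t) 3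
  have h := is_const_of_deriv_eq_zero (fun t => (hd t).differentiableAt)
    (fun t => (hd t).deriv) 1 0
  simpa using h

/-- Uniqueness for the linear ODE identifies the exponential with an explicit rotation. At π it is a
diagonal involution, which is why conjugation by it is simple. -/
theorem exp_pi_rotOp_apply (p : Fin 4 → ℝ) :
    NormedSpace.exp (Real.pi • rotOp) p = ![p 0, -(p 1), -(p 2), p 3] := by
  have hlip : ∀ _ : ℝ, LipschitzOnWith ‖rotOp‖₊ (fun p => rotOp p) Set.univ :=
    fun _ => rotOp.lipschitz.lipschitzOnWith
  have hexp : ∀ t : ℝ, HasDerivAt (fun s : ℝ => NormedSpace.exp (s • rotOp) p)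
      (rotOp (NormedSpace.exp (t • rotOp) p)) t ∧
      NormedSpace.exp (t • rotOp) p ∈ (Set.univ : Set (Fin 4 → ℝ)) :=
    fun t => ⟨hasDerivAt_exp_smul_apply rotOp p t, trivial⟩
  set g : ℝ → Fin 4 → ℝ := fun t => ![p 0, p 1 * Real.cos t - p 2 * Real.sin t,
      p 1 * Real.sin t + p 2 * Real.cos t, p 3] with hg
  have hrot : ∀ t : ℝ, HasDerivAt g (rotOp (g t)) t ∧ g t ∈ (Set.univ : Set (Fin 4 → ℝ)) := by
    refine fun t => ⟨?_, trivial⟩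
    rw [rotOp_apply, hasDerivAt_pi]
    intro i
    fin_cases i
    · exact hasDerivAt_const t (p 0)
    · refine (((Real.hasDerivAt_cos t).const_mul (p 1)).sub
        ((Real.hasDerivAt_sin t).const_mul (p 2))).congr_deriv ?_
      simp [hg]
      ring
    · refine (((Real.hasDerivAt_sin t).const_mul (p 1)).add
        ((Real.hasDerivAt_cos t).const_mul (p 2))).congr_deriv ?_
      simp [hg]
      ring
    · exact hasDerivAt_const t (p 3)
  have h0 : (fun s : ℝ => NormedSpace.exp (s • rotOp) p) 0 = g 0 := by
    ext i
    fin_cases i <;> simp [hg]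
  have h := congrFun (ODE_solution_unique_univ hlip hexp hrot h0) Real.pi
  simpa [hg] using h

/-! ### Invariance of the closure -/

/-- The closure of the coherently reachable set, in homogeneous coordinates. -/
def homogeneousClosure (ω κ γ : ℝ) (r₀ : BlochVec) : Set (Fin 4 → ℝ) :=
  {p | toBloch p ∈ closure (reachableCoherent ω κ γ r₀) ∧ p 3 = 1}

theorem isClosed_homogeneousClosure (ω κ γ : ℝ) (r₀ : BlochVec) :
    IsClosed (homogeneousClosure ω κ γ r₀) :=
  (isClosed_closure.preimage toBloch.continuous).inter
    (isClosed_eq (continuous_apply 3) continuous_const)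

theorem mapsTo_exp_drift_add_rot {ω κ : ℝ} (γ : ℝ) (hω : 0 < ω) (hκ : 0 < κ) (r₀ : BlochVec)
    {a : ℝ} (ha : 0 < a) (c : ℝ) :
    Set.MapsTo (⇑(NormedSpace.exp (a • driftOp ω γ + c • rotOp)))
      (homogeneousClosure ω κ γ r₀) (homogeneousClosure ω κ γ r₀) := by
  rintro p ⟨hp, hp1⟩
  set M := driftOp ω γ + (c / a) • rotOp with hM
  have hM3 : ∀ t : ℝ, ∀ p, (t • M) p 3 = 0 := fun t p => by
    simp [hM, driftOp_apply, rotOp_apply]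
  have haM : a • driftOp ω γ + c • rotOp = a • M := by
    rw [hM, smul_add, smul_smul, mul_div_cancel₀ _ ha.ne']
  rw [haM]
  refine ⟨?_, (exp_apply_last _ (hM3 a) _).trans hp1⟩
  rw [← ofBloch_toBloch hp1]
  refine map_mem_closure (f := fun y : BlochVec => toBloch (NormedSpace.exp (a • M) (ofBloch y)))
    (by have := continuous_ofBloch; fun_prop) hp fun y hy => ?_
  -- Running for time `a` with rotation rate `c / a = 2 * κ * u` gives total rotation `c`.
  refine mem_reachableCoherent_of_flow hy (c / a / (2 * κ))
    (y := fun t => toBloch (NormedSpace.exp (t • M) (ofBloch y)))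
    (by simp [toBloch_ofBloch]) (fun t => ?_) ha.le
  have h2 : NormedSpace.exp (t • M) (ofBloch y) 3 = 1 := exp_apply_last _ (hM3 t) (ofBloch y)
  have h1 := toBloch.hasFDerivAt.comp_hasDerivAt t (hasDerivAt_exp_smul_apply M (ofBloch y) t)
  refine h1.congr_deriv ?_
  generalize NormedSpace.exp (t • M) (ofBloch y) = p at h2
  have hc : 2 * κ * (c / a / (2 * κ)) = c / a := by field_simp
  rw [velocity_eq hω, hc]
  ext i
  fin_cases i <;> simp [hM, driftOp_apply, rotOp_apply, toBloch_apply, h2] <;> ring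

/-- Let the duration `a` tend to `0` with the total rotation `c` fixed: the drift disappears, and
closedness keeps the limit. -/
theorem mapsTo_exp_rot {ω κ : ℝ} (γ : ℝ) (hω : 0 < ω) (hκ : 0 < κ) (r₀ : BlochVec) (c : ℝ) :
    Set.MapsTo (⇑(NormedSpace.exp (c • rotOp)))
      (homogeneousClosure ω κ γ r₀) (homogeneousClosure ω κ γ r₀) := by
  intro p hp
  let _ : NormedAlgebra ℚ ((Fin 4 → ℝ) →L[ℝ] (Fin 4 → ℝ)) := .restrictScalars ℚ ℝ _
  have hcont : Continuous fun a : ℝ => NormedSpace.exp (a • driftOp ω γ + c • rotOp) p :=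
    (NormedSpace.exp_continuous.comp (by fun_prop)).clm_apply continuous_const
  have hlim := (hcont.tendsto 0).mono_left (nhdsWithin_le_nhds (s := Set.Ioi 0))
  simp only [zero_smul, zero_add] at hlim
  refine (isClosed_homogeneousClosure ω κ γ r₀).mem_of_tendsto hlim ?_
  filter_upwards [self_mem_nhdsWithin] with a ha
  exact mapsTo_exp_drift_add_rot γ hω hκ r₀ ha c hp

theorem mapsTo_exp_drift_add_rot_of_nonneg {ω κ : ℝ} (γ : ℝ) (hω : 0 < ω) (hκ : 0 < κ)
    (r₀ : BlochVec) {a : ℝ} (ha : 0 ≤ a) (c : ℝ) :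
    Set.MapsTo (⇑(NormedSpace.exp (a • driftOp ω γ + c • rotOp)))
      (homogeneousClosure ω κ γ r₀) (homogeneousClosure ω κ γ r₀) := by
  rcases ha.eq_or_lt with rfl | ha
  · simpa using mapsTo_exp_rot γ hω hκ r₀ c
  · exact mapsTo_exp_drift_add_rot γ hω hκ r₀ ha c

/-! ### Tangency and conclusion -/

/-- Every velocity of the system with a nonnegative incoherent control is tangent to the closure
of the coherently reachable set: conjugating the drift by the rotation through `π` about the
first axis and averaging produces `f₂`. -/
theorem exists_tangent_curve {ω κ : ℝ} (γ : ℝ) (hω : 0 < ω) (hκ : 0 < κ) (r₀ : BlochVec)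
    (u : ℝ) {n : ℝ} (hn : 0 ≤ n) {y : BlochVec}
    (hy : y ∈ closure (reachableCoherent ω κ γ r₀)) :
    ∃ c : ℝ → BlochVec, c 0 = y ∧ HasDerivAt c (velocity ω κ γ y u n) 0 ∧
      ∀ h, 0 ≤ h → c h ∈ closure (reachableCoherent ω κ γ r₀) := by
  set Q := NormedSpace.exp (Real.pi • rotOp) with hQ
  set A := (n / 2) • driftOp ω γ with hA
  set B := driftOp ω γ + (2 * κ * u) • rotOp with hB
  have hQp : ∀ p, Q p = ![p 0, -(p 1), -(p 2), p 3] := exp_pi_rotOp_apply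
  have hAt := hasDerivAt_exp_smul_const' (𝕂 := ℝ) A 0
  have hBt := hasDerivAt_exp_smul_const' (𝕂 := ℝ) B 0
  have hQt := hasDerivAt_const (0 : ℝ) Q
  -- The curve is `Q e^{hA} Q e^{hA} e^{hB}` applied to `y`. As `Q² = 1`, its generator at `0` is
  -- `QAQ + A + B`; the factor `n / 2` in `A` makes `QAQ + A` equal to `γ n f₂`.
  have hder := toBloch.hasFDerivAt.comp_hasDerivAt 0
    (((((hQt.mul hAt).mul hQt).mul hAt).mul hBt).clm_apply
      (hasDerivAt_const (0 : ℝ) (ofBloch y)))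
  refine ⟨_, ?_, hder.congr_deriv ?_, fun h hh => ?_⟩
  · ext i
    fin_cases i <;> simp [hQp, toBloch_apply, ofBloch]
  · rw [velocity_eq hω]
    ext i
    fin_cases i <;>
      simp [hA, hB, hQp, driftOp_apply, rotOp_apply, toBloch_apply, ofBloch] <;> ring
  · have hmA : Set.MapsTo (⇑(NormedSpace.exp (h • A)))
        (homogeneousClosure ω κ γ r₀) (homogeneousClosure ω κ γ r₀) := by
      have := mapsTo_exp_drift_add_rot_of_nonneg γ hω hκ r₀ (a := h * (n / 2)) (by positivity) 0
      simpa [hA, smul_smul] using this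
    have hmB : Set.MapsTo (⇑(NormedSpace.exp (h • B)))
        (homogeneousClosure ω κ γ r₀) (homogeneousClosure ω κ γ r₀) := by
      have := mapsTo_exp_drift_add_rot_of_nonneg γ hω hκ r₀ hh (h * (2 * κ * u))
      simpa [hB, smul_smul, smul_add] using this
    have hmQ := mapsTo_exp_rot γ hω hκ r₀ Real.pi
    have hp : ofBloch y ∈ homogeneousClosure ω κ γ r₀ := ⟨by rwa [toBloch_ofBloch], rfl⟩
    exact (hmQ (hmA (hmQ (hmA (hmB hp))))).1

theorem reachableCoherent_subset_reachableBoth (ω κ γ : ℝ) (r₀ : BlochVec) :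
    reachableCoherent ω κ γ r₀ ⊆ reachableBoth ω κ γ r₀ := by
  rintro x ⟨T, u, r, hT, hu, hr, hx⟩
  exact ⟨T, u, fun _ => 0, r, hT, hu, by simp, fun _ _ => le_rfl, hr, hx⟩

theorem reachableBoth_subset_closure_reachableCoherent {ω κ γ : ℝ} (hω : 0 < ω) (hκ : 0 < κ)
    (hγ : 0 ≤ γ) (r₀ : BlochVec) :
    reachableBoth ω κ γ r₀ ⊆ closure (reachableCoherent ω κ γ r₀) := by
  rintro x ⟨T, u, n, r, hT, hu, hn, hn0, ⟨hrc, hr⟩, rfl⟩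
  exact mem_of_dissipative_of_tangent isClosed_closure hT
    (f := fun t x => velocity ω κ γ x (u t) (n t))
    (subset_closure (self_mem_reachableCoherent ω κ γ r₀))
    (intervalIntegrable_velocity κ γ hT hu hn hrc) hr
    (fun t ht x y => inner_velocity_sub_nonpos hω hγ (u t) (hn0 t ht) x y)
    (fun t ht y hy => exists_tangent_curve γ hω hκ r₀ (u t) (hn0 t ht) hy)

end

end BlochControl

theorem theorem1 (ω κ γ : ℝ) (hω : 0 < ω) (hκ : 0 < κ) (hγ : 0 ≤ γ)
    (r₀ : BlochControl.BlochVec) :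
    closure (BlochControl.reachableCoherent ω κ γ r₀) =
      closure (BlochControl.reachableBoth ω κ γ r₀) :=
  (closure_mono (BlochControl.reachableCoherent_subset_reachableBoth ω κ γ r₀)).antisymm
    (closure_minimal
      (BlochControl.reachableBoth_subset_closure_reachableCoherent hω hκ hγ r₀) isClosed_closure)
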